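/- Let $X=(x_{ij})\in\mathbb{R}^{n\times p}$ be a data matrix with columns $X_1,\dots,X_p$, and let $A$ be an undirected simple graph on the $n$ individuals (rows). The network Gaussian DAG model for a directed acyclic graph $G$ on the nodes $\{1,\dots,p\}$ is $$X_j=\sum_{k\in\Pi_j}\beta_{kj}X_k+\varepsilon_j,\qquad \varepsilon_j\sim\mathcal N_n(0,\omega_j^2\Sigma)\ \text{ independent over } j,$$ where $\Pi_j$ is the set of parents of $j$ in $G$. Its parameters are $(B,\Omega,\Theta)$ with $B=(\beta_{kj})_{p\times p}$, where $\beta_{kj}=0$ unless $k\to j$ is an edge of $G$; $\Omega=\mathrm{diag}(\omega_1^2,\dots,\omega_p^2)$ with all $\omega_j^2>0$; and $\Theta=\Sigma^{-1}$ an $n\times n$ positive definite matrix with $\mathrm{diag}(\Theta^{-1})=1$ and $\theta_{ik}=0$ whenever $i\neq k$ and $\{i,k\}$ is not an edge of $A$. Up to a factor $2$ and an additive constant, the negative log-likelihood is $$L(B,\Omega,\Theta\mid X)=-n\log\det\Omega^{-1}-p\log\det\Theta+p\,\mathrm{Tr}(\Theta S),\qquad S=\frac1p\sum_{j=1}^p\frac1{\omega_j^2}(X_j-X\beta_j)(X_j-X\beta_j)^\top,$$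 where $\beta_j$ is the $j$-th column of $B$. A maximum likelihood estimate (MLE) given $G$ is a minimizer of $L(\cdot\mid X)$ over all such $(B,\Omega,\Theta)$. Two DAGs on the same nodes are Markov equivalent if they have the same d-separations among pairwise disjoint sets of nodes. Theorem. Let $G_1$ and $G_2$ be Markov equivalent DAGs on the same $p$ nodes. If MLEs $(\widehat B(G_m),\widehat\Omega(G_m),\widehat\Theta(G_m))$, $m=1,2$, exist for the matrix $X$ (with the same $A$), then $$L(\widehat B(G_1),\widehat\Omega(G_1),\widehat\Theta(G_1)\mid X)=L(\widehat B(G_2),\widehat\Omega(G_2),\widehat\Theta(G_2)\mid X).$$ -/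

import Mathlib

/-- A directed graph is acyclic (a DAG) if it has no directed cycle; loops are cycles. -/
def IsDAG {V : Type*} (G : Digraph V) : Prop :=
  ∀ v, ¬ Relation.TransGen G.Adj v v

/-- The skeleton: the simple graph obtained by forgetting the directions of the edges. -/
def skeleton {V : Type*} (G : Digraph V) : SimpleGraph V :=
  G.toSimpleGraphInclusive

/-- `w` is a descendant of `v` (every node is a descendant of itself). -/
def IsDescendant {V : Type*} (G : Digraph V) (w v : V) : Prop :=
  Relation.ReflTransGen G.Adj v w

/-- On a walk in the skeleton, the `i`-th node is a collider: both edges of the walk at this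
interior node point into it. -/
def IsColliderAt {V : Type*} (G : Digraph V) {x y : V} (w : (skeleton G).Walk x y) (i : ℕ) :
    Prop :=
  G.Adj (w.getVert (i - 1)) (w.getVert i) ∧ G.Adj (w.getVert (i + 1)) (w.getVert i)

/-- A walk in the skeleton is blocked by `Z` if some interior node either is a non-collider
(the middle of a chain or a fork) that lies in `Z`, or is a collider that has no descendant
in `Z` (in particular it is not in `Z` itself). -/
def IsBlocked {V : Type*} (G : Digraph V) {x y : V} (w : (skeleton G).Walk x y) (Z : Set V) :
    Prop :=
  ∃ i, 0 < i ∧ i < w.length ∧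
    ((¬ IsColliderAt G w i ∧ w.getVert i ∈ Z) ∨
      (IsColliderAt G w i ∧ ∀ d, IsDescendant G d (w.getVert i) → d ∉ Z))

/-- `Z` d-separates `X` from `Y`: every path of the skeleton from a node of `X` to a node of `Y`
is blocked by `Z`. -/
def DSeparated {V : Type*} (G : Digraph V) (X Y Z : Set V) : Prop :=
  ∀ x ∈ X, ∀ y ∈ Y, ∀ w : (skeleton G).Walk x y, w.IsPath → IsBlocked G w Z

/-- Markov equivalence of two DAGs on the same nodes: they entail the same conditional
independence statements, that is, they have the same d-separations among pairwise disjoint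
sets of nodes. -/
def MarkovEquivalent {V : Type*} (G₁ G₂ : Digraph V) : Prop :=
  ∀ X Y Z : Set V, Disjoint X Y → Disjoint X Z → Disjoint Y Z →
    (DSeparated G₁ X Y Z ↔ DSeparated G₂ X Y Z)

/-- The parameters `(B, Ω, Θ)` of the network Gaussian DAG model with `n` individuals (rows of
the data matrix) and `p` variables (columns): `B` holds the edge weights, `Ω` is the diagonal
matrix of the noise variances `ω_j ^ 2`, and `Θ = Σ⁻¹` is the precision matrix of the rows. -/
structure ModelParams (n p : ℕ) where
  B : Matrix (Fin p) (Fin p) ℝ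
  Ω : Matrix (Fin p) (Fin p) ℝ
  Θ : Matrix (Fin n) (Fin n) ℝ

/-- The parameter set of the model given the DAG `G` on the variables and the undirected network
`A` on the individuals: `β_kj = 0` unless `k → j` is an edge of `G`; `Ω` is diagonal with positive
diagonal; `Θ` is positive definite with off-diagonal support contained in the edges of `A`, and
its inverse `Σ` is a correlation matrix. -/
def parameterSet {n p : ℕ} (G : Digraph (Fin p)) (A : SimpleGraph (Fin n)) :
    Set (ModelParams n p) :=
  {θ | (∀ k j, ¬ G.Adj k j → θ.B k j = 0) ∧
    (θ.Ω.IsDiag ∧ ∀ j, 0 < θ.Ω j j) ∧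
    (θ.Θ.PosDef ∧ (∀ i k, i ≠ k → ¬ A.Adj i k → θ.Θ i k = 0) ∧ ∀ i, (θ.Θ⁻¹) i i = 1)}

/-- `S = (1 / p) ∑_j (1 / ω_j ^ 2) (X_j - X β_j) (X_j - X β_j)ᵀ`, an `n × n` matrix; here `X_j` and
`β_j` are the `j`-th columns of `X` and `B`. -/
noncomputable def rowScatter {n p : ℕ} (X : Matrix (Fin n) (Fin p) ℝ)
    (B Ω : Matrix (Fin p) (Fin p) ℝ) : Matrix (Fin n) (Fin n) ℝ :=
  (1 / (p : ℝ)) • ∑ j, (1 / Ω j j) •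
    Matrix.vecMulVec (X.col j - X.mulVec (B.col j)) (X.col j - X.mulVec (B.col j))

/-- The negative log-likelihood of the data `X` (times two, and without the additive constant
`n p log (2 π)`): `-n log det (Ω⁻¹) - p log det Θ + p tr (Θ S)`. -/
noncomputable def negLogLik {n p : ℕ} (X : Matrix (Fin n) (Fin p) ℝ) (θ : ModelParams n p) : ℝ :=
  -(n : ℝ) * Real.log (θ.Ω⁻¹).det - (p : ℝ) * Real.log θ.Θ.det
    + (p : ℝ) * (θ.Θ * rowScatter X θ.B θ.Ω).trace

/-- `θ` is a maximum likelihood estimate given the DAG `G` and the network `A`: it lies in the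
parameter set and minimizes the negative log-likelihood over it. -/
def IsMLE {n p : ℕ} (G : Digraph (Fin p)) (A : SimpleGraph (Fin n))
    (X : Matrix (Fin n) (Fin p) ℝ) (θ : ModelParams n p) : Prop :=
  θ ∈ parameterSet G A ∧ IsMinOn (negLogLik X) (parameterSet G A) θ

/-!
The negative log-likelihood sees `(B, Ω)` only through `det Ω⁻¹` and the row scatter matrix, which
is a weighted sum of `r_j r_jᵀ` over the residuals `r_j = X_j - X β_j`. It therefore suffices to
show that Markov equivalent DAGs `G₁`, `G₂` parametrize the same pairs of these quantities; the two
minima are then minima of the same set of values.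

Markov equivalent DAGs have the same adjacencies and the same immoralities (`a → c ← b` with `a`,
`b` not adjacent): two non-adjacent nodes are d-separated by the parents of one of them, adjacent
nodes are never d-separated, and whether a set separating `a` from `b` contains a common neighbour
`c` tells whether `c` is a collider between them (`MarkovEquivalent.sameImmoralities`).

Two DAGs with the same adjacencies and immoralities are linked by reversals of covered edges, that
is, of edges `x → y` for which the parents of `y` are `x` and the parents of `x`
(Chickering's theorem). Such an edge is found among those on which `G₁` and `G₂` disagree by taking
`y` minimal and then `x` maximal in the ancestral order of `G₁` (`exists_isCovered`), and its
reversal brings `G₁` closer to `G₂`.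

Reversing a covered edge only requires changing the regressions of `x` and `y`, which amounts to
completing the square the other way round in the sum of two rank-one terms; this preserves the row
scatter matrix and the product of the two noise variances
(`IsCovered.exists_negLogLik_eq`).
-/

/-! ### Adjacencies and immoralities are determined by d-separation -/

/-- Two nodes of a directed graph are adjacent if there is an edge between them, in either
direction. -/
def DAdjacent {V : Type*} (G : Digraph V) (a b : V) : Prop :=
  G.Adj a b ∨ G.Adj b a

/-- The directed graphs have the same adjacencies and the same immoralities, that is, the same
induced subgraphs `a → c ← b` with `a` and `b` distinct and not adjacent. -/
structure SameImmoralities {V : Type*} (G₁ G₂ : Digraph V) : Prop where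
  adj : ∀ a b, DAdjacent G₁ a b ↔ DAdjacent G₂ a b
  imm : ∀ a b c, a ≠ b → ¬ DAdjacent G₁ a b →
    (G₁.Adj a c ∧ G₁.Adj b c ↔ G₂.Adj a c ∧ G₂.Adj b c)

section DSeparation

variable {V : Type*} {G G₁ G₂ : Digraph V}

theorem DAdjacent.symm {a b : V} (h : DAdjacent G a b) : DAdjacent G b a :=
  Or.symm h

theorem IsDAG.irrefl (hG : IsDAG G) (a : V) : ¬ G.Adj a a :=
  fun h => hG a (.single h)

theorem IsDAG.asymm (hG : IsDAG G) {a b : V} (h : G.Adj a b) : ¬ G.Adj b a :=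
  fun h' => hG a (.tail (.single h) h')

theorem skeleton_adj {a b : V} : (skeleton G).Adj a b ↔ a ≠ b ∧ DAdjacent G a b := by
  simp [skeleton, Digraph.toSimpleGraphInclusive, DAdjacent]

theorem DAdjacent.not_dSeparated {a b : V} (h : DAdjacent G a b) (hab : a ≠ b) (Z : Set V) :
    ¬ DSeparated G {a} {b} Z := by
  intro hs
  have hadj : (skeleton G).Adj a b := skeleton_adj.2 ⟨hab, h⟩
  obtain ⟨i, hi, hi', -⟩ := hs a rfl b rfl hadj.toWalk (by simp [hab])
  simp only [SimpleGraph.Walk.length_cons, SimpleGraph.Walk.length_nil] at hi'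
  omega

theorem IsDAG.dSeparated_parents (hG : IsDAG G) {a b : V} (hadj : ¬ DAdjacent G a b)
    (hdesc : ¬ IsDescendant G b a) : DSeparated G {a} {b} {k | G.Adj k a} := by
  classical
  suffices h : ∀ w : (skeleton G).Walk a b, IsBlocked G w {k | G.Adj k a} by
    rintro _ rfl _ rfl w -
    exact h w
  intro w
  -- The first edge of the walk that does not point forward starts either at `a` or at a collider.
  have hex : ∃ i, i < w.length ∧ ¬ G.Adj (w.getVert i) (w.getVert (i + 1)) := by
    by_contra! hall
    refine hdesc ?_
    have hreach : ∀ i ≤ w.length, IsDescendant G (w.getVert i) a := by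
      intro i
      induction i with
      | zero => intro _; rw [w.getVert_zero]; exact .refl
      | succ i ih => intro hi; exact .tail (ih (by omega)) (hall i (by omega))
    simpa using hreach w.length le_rfl
  obtain ⟨hlt, hnot⟩ := Nat.find_spec hex
  have hfwd : ∀ j < Nat.find hex, G.Adj (w.getVert j) (w.getVert (j + 1)) := by
    intro j hj
    by_contra h
    exact Nat.find_min hex hj ⟨by omega, h⟩
  generalize Nat.find hex = i at hlt hnot hfwd
  have hback : G.Adj (w.getVert (i + 1)) (w.getVert i) :=
    ((skeleton_adj.1 (w.adj_getVert_succ hlt)).2).resolve_left hnot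
  rcases Nat.eq_zero_or_pos i with rfl | hi
  · rw [w.getVert_zero] at hback
    have hlen : 1 < w.length := by
      by_contra hle
      have h1 : w.length = 1 := by omega
      have : w.getVert 1 = b := h1 ▸ w.getVert_length
      rw [zero_add, this] at hback
      exact hadj (.inr hback)
    refine ⟨1, one_pos, hlen, .inl ⟨?_, hback⟩⟩
    rintro ⟨h, -⟩
    rw [Nat.sub_self, w.getVert_zero] at h
    exact hG.asymm hback h
  · have hreach : ∀ j ≤ i, Relation.ReflTransGen G.Adj (w.getVert 0) (w.getVert j) := by
      intro j
      induction j with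
      | zero => intro _; exact .refl
      | succ j ih => intro hj; exact .tail (ih (by omega)) (hfwd j (by omega))
    refine ⟨i, hi, hlt, .inr ⟨⟨?_, hback⟩, ?_⟩⟩
    · have := hfwd (i - 1) (by omega)
      rwa [Nat.sub_add_cancel hi] at this
    · intro d hd hda
      have hid := hreach i le_rfl
      rw [w.getVert_zero] at hid
      exact hG _ (.tail' (hid.trans hd) hda)

theorem IsDAG.exists_dSeparated (hG : IsDAG G) {a b : V} (hab : a ≠ b)
    (hadj : ¬ DAdjacent G a b) :
    (∃ Z : Set V, a ∉ Z ∧ b ∉ Z ∧ DSeparated G {a} {b} Z) ∨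
      ∃ Z : Set V, a ∉ Z ∧ b ∉ Z ∧ DSeparated G {b} {a} Z := by
  by_cases h : IsDescendant G b a
  · have h' : ¬ IsDescendant G a b := by
      intro h'
      rcases Relation.reflTransGen_iff_eq_or_transGen.1 h with rfl | h
      · exact hab rfl
      · exact hG a (h.trans_left h')
    exact .inr ⟨{k | G.Adj k b}, fun h => hadj (.inl h), hG.irrefl b,
      hG.dSeparated_parents (fun h => hadj h.symm) h'⟩
  · exact .inl ⟨{k | G.Adj k a}, hG.irrefl a, fun h => hadj (.inr h), hG.dSeparated_parents hadj h⟩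

theorem MarkovEquivalent.symm (h : MarkovEquivalent G₁ G₂) : MarkovEquivalent G₂ G₁ :=
  fun X Y Z hXY hXZ hYZ => (h X Y Z hXY hXZ hYZ).symm

theorem MarkovEquivalent.dSeparated (h : MarkovEquivalent G₁ G₂) {a b : V} {Z : Set V}
    (hab : a ≠ b) (ha : a ∉ Z) (hb : b ∉ Z) (hs : DSeparated G₁ {a} {b} Z) :
    DSeparated G₂ {a} {b} Z :=
  (h {a} {b} Z (by simpa using hab) (by simpa using ha) (by simpa using hb)).1 hs

theorem MarkovEquivalent.dAdjacent (h : MarkovEquivalent G₁ G₂) (hG₁ : IsDAG G₁)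
    (hG₂ : IsDAG G₂) {a b : V} (hadj : DAdjacent G₂ a b) : DAdjacent G₁ a b := by
  have hab : a ≠ b := by
    rintro rfl
    exact hadj.elim (hG₂.irrefl a) (hG₂.irrefl a)
  by_contra hn
  rcases hG₁.exists_dSeparated hab hn with ⟨Z, ha, hb, hs⟩ | ⟨Z, ha, hb, hs⟩
  · exact hadj.not_dSeparated hab Z (h.dSeparated hab ha hb hs)
  · exact hadj.symm.not_dSeparated hab.symm Z (h.dSeparated hab.symm hb ha hs)

/-- The two-edge path `a - c - b` is blocked by `Z` exactly when `c` is a collider without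
descendant in `Z` or a non-collider in `Z`. -/
theorem DSeparated.middle {a b c : V} {Z : Set V} (hs : DSeparated G {a} {b} Z) (hab : a ≠ b)
    (hac : (skeleton G).Adj a c) (hcb : (skeleton G).Adj c b) :
    (¬ (G.Adj a c ∧ G.Adj b c) ∧ c ∈ Z) ∨
      (G.Adj a c ∧ G.Adj b c) ∧ ∀ d, IsDescendant G d c → d ∉ Z := by
  obtain ⟨i, hi, hi', h⟩ := hs a rfl b rfl (.cons hac (.cons hcb .nil))
    (by simp [hab, hac.ne, hcb.ne])
  simp only [SimpleGraph.Walk.length_cons, SimpleGraph.Walk.length_nil] at hi'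
  obtain rfl : i = 1 := by omega
  simpa [IsColliderAt] using h

theorem MarkovEquivalent.collider (h : MarkovEquivalent G₁ G₂) (hG₁ : IsDAG G₁)
    (hG₂ : IsDAG G₂) {a b c : V} (hab : a ≠ b) (hn : ¬ DAdjacent G₁ a b)
    (hac : G₁.Adj a c) (hbc : G₁.Adj b c) : G₂.Adj a c ∧ G₂.Adj b c := by
  have key : ∀ {a b : V}, a ≠ b → G₁.Adj a c → G₁.Adj b c →
      (∃ Z : Set V, a ∉ Z ∧ b ∉ Z ∧ DSeparated G₁ {a} {b} Z) → G₂.Adj a c ∧ G₂.Adj b c := by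
    rintro a b hab hac hbc ⟨Z, ha, hb, hs⟩
    have hac' : a ≠ c := by rintro rfl; exact hG₁.irrefl _ hac
    have hbc' : c ≠ b := by rintro rfl; exact hG₁.irrefl _ hbc
    have h₁ := hs.middle hab (skeleton_adj.2 ⟨hac', .inl hac⟩) (skeleton_adj.2 ⟨hbc', .inr hbc⟩)
    have h₂ := (h.dSeparated hab ha hb hs).middle hab
      (skeleton_adj.2 ⟨hac', h.symm.dAdjacent hG₂ hG₁ (.inl hac)⟩)
      (skeleton_adj.2 ⟨hbc', h.symm.dAdjacent hG₂ hG₁ (.inr hbc)⟩)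
    rcases h₁ with h₁ | h₁
    · exact absurd ⟨hac, hbc⟩ h₁.1
    · exact h₂.elim (fun h₂ => absurd h₂.2 (h₁.2 c .refl)) And.left
  rcases hG₁.exists_dSeparated hab hn with hZ | ⟨Z, ha, hb, hs⟩
  · exact key hab hac hbc hZ
  · exact (key hab.symm hbc hac ⟨Z, hb, ha, hs⟩).symm

theorem MarkovEquivalent.sameImmoralities (h : MarkovEquivalent G₁ G₂) (hG₁ : IsDAG G₁)
    (hG₂ : IsDAG G₂) : SameImmoralities G₁ G₂ where
  adj _ _ := ⟨h.symm.dAdjacent hG₂ hG₁, h.dAdjacent hG₁ hG₂⟩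
  imm _ _ _ hab hn :=
    ⟨fun h' => h.collider hG₁ hG₂ hab hn h'.1 h'.2,
      fun h' => h.symm.collider hG₂ hG₁ hab (fun h'' => hn (h.dAdjacent hG₁ hG₂ h'')) h'.1 h'.2⟩

end DSeparation

/-! ### Covered edges -/

/-- The edge `x → y` is covered: the parents of `y` are `x` and the parents of `x`. -/
def IsCovered {V : Type*} (G : Digraph V) (x y : V) : Prop :=
  ∀ k, G.Adj k y ↔ G.Adj k x ∨ k = x

/-- The directed graph with `x → y` replaced by `y → x`. -/
def reverseEdge {V : Type*} (G : Digraph V) (x y : V) : Digraph V where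
  Adj a b := (G.Adj a b ∧ ¬ (a = x ∧ b = y)) ∨ (a = y ∧ b = x)

section CoveredEdges

variable {V : Type*} {G G₁ G₂ : Digraph V} {x y : V}

theorem reverseEdge_adj {a b : V} :
    (reverseEdge G x y).Adj a b ↔ (G.Adj a b ∧ ¬ (a = x ∧ b = y)) ∨ (a = y ∧ b = x) :=
  Iff.rfl

theorem IsCovered.adj (h : IsCovered G x y) : G.Adj x y :=
  (h x).2 (.inr rfl)

theorem IsCovered.ne (h : IsCovered G x y) (hG : IsDAG G) : x ≠ y := by
  rintro rfl
  exact hG.irrefl _ h.adj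

theorem IsCovered.isDAG_reverseEdge (h : IsCovered G x y) (hG : IsDAG G) :
    IsDAG (reverseEdge G x y) := by
  -- A directed path after the reversal either avoids `y → x`, or it starts with a path to `y` and
  -- ends with a path from `x`, both using only edges of `G` other than `x → y`.
  let r : V → V → Prop := fun a b => G.Adj a b ∧ ¬ (a = x ∧ b = y)
  have split : ∀ a b, Relation.TransGen (reverseEdge G x y).Adj a b →
      Relation.TransGen r a b ∨ (Relation.ReflTransGen r a y ∧ Relation.ReflTransGen r x b) := by
    intro a b hab
    induction hab with
    | single hab =>
      rcases hab with hab | ⟨rfl, rfl⟩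
      · exact .inl (.single hab)
      · exact .inr ⟨.refl, .refl⟩
    | tail _ hbc ih =>
      rcases hbc with hbc | ⟨rfl, rfl⟩
      · exact ih.imp (fun h => h.tail hbc) (fun h => ⟨h.1, h.2.tail hbc⟩)
      · exact .inr ⟨ih.elim (fun h => h.to_reflTransGen) (fun h => h.1), .refl⟩
  have hr : ∀ a b, r a b → G.Adj a b := fun _ _ h => h.1
  intro v hv
  rcases split v v hv with hv | ⟨hvy, hxv⟩
  · exact hG v (Relation.TransGen.mono hr _ _ hv)
  · rcases Relation.ReflTransGen.cases_tail (hxv.trans hvy) with hyx | ⟨z, hxz, hzy, hne⟩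
    · exact h.ne hG hyx.symm
    · rcases (h z).1 hzy with hzx | rfl
      · exact hG x (.tail' (Relation.ReflTransGen.mono hr _ _ hxz) hzx)
      · exact hne ⟨rfl, rfl⟩

theorem IsCovered.dAdjacent_reverseEdge (h : IsCovered G x y) (a b : V) :
    DAdjacent (reverseEdge G x y) a b ↔ DAdjacent G a b := by
  have hxy := h.adj
  simp only [DAdjacent, reverseEdge_adj]
  grind

theorem IsCovered.sameImmoralities_reverseEdge (h : IsCovered G x y) (hG : IsDAG G) :
    SameImmoralities (reverseEdge G x y) G where
  adj := h.dAdjacent_reverseEdge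
  imm a b c hab hn := by
    rw [h.dAdjacent_reverseEdge, DAdjacent] at hn
    have hxy := h.adj
    have hne := h.ne hG
    have hyx := hG.asymm hxy
    have ha := h a
    have hb := h b
    simp only [reverseEdge_adj]
    grind

theorem SameImmoralities.trans {G₃ : Digraph V} (h : SameImmoralities G₁ G₂)
    (h' : SameImmoralities G₂ G₃) : SameImmoralities G₁ G₃ where
  adj a b := (h.adj a b).trans (h'.adj a b)
  imm a b c hab hn :=
    (h.imm a b c hab hn).trans (h'.imm a b c hab (fun h'' => hn ((h.adj a b).2 h'')))

theorem IsDAG.wellFounded_transGen [Finite V] (hG : IsDAG G) :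
    WellFounded (Relation.TransGen G.Adj) :=
  haveI : Std.Irrefl (Relation.TransGen G.Adj) := ⟨hG⟩
  Finite.wellFounded_of_trans_of_irrefl _

theorem IsDAG.wellFounded_swap_transGen [Finite V] (hG : IsDAG G) :
    WellFounded (Function.swap (Relation.TransGen G.Adj)) :=
  haveI : Std.Irrefl (Function.swap (Relation.TransGen G.Adj)) := ⟨hG⟩
  haveI : IsTrans V (Function.swap (Relation.TransGen G.Adj)) := ⟨fun _ _ _ h h' => h'.trans h⟩
  Finite.wellFounded_of_trans_of_irrefl _

/-- If two DAGs with the same adjacencies and immoralities disagree on some edge, they disagree on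
an edge that is covered in the first. -/
theorem SameImmoralities.exists_isCovered [Finite V] (h : SameImmoralities G₁ G₂)
    (hG₁ : IsDAG G₁) (hG₂ : IsDAG G₂) (hex : ∃ x y, G₁.Adj x y ∧ G₂.Adj y x) :
    ∃ x y, IsCovered G₁ x y ∧ G₂.Adj y x := by
  obtain ⟨y, hy, hymin⟩ := hG₁.wellFounded_transGen.has_min
    {y | ∃ x, G₁.Adj x y ∧ G₂.Adj y x} (by obtain ⟨x, y, h⟩ := hex; exact ⟨y, x, h⟩)
  obtain ⟨x, ⟨hxy, hyx⟩, hxmax⟩ := hG₁.wellFounded_swap_transGen.has_min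
    {x | G₁.Adj x y ∧ G₂.Adj y x} hy
  -- By minimality of `y`, the graphs agree on the edges into every parent of `y`.
  have agree : ∀ {z k}, G₁.Adj z y → G₁.Adj k z → G₂.Adj k z := by
    intro z k hzy hkz
    refine ((h.adj k z).1 (.inl hkz)).resolve_right fun hzk => ?_
    exact hymin z ⟨k, hkz, hzk⟩ (.single hzy)
  refine ⟨x, y, fun k => ⟨fun hky => ?_, ?_⟩, hyx⟩
  · by_cases hkx : k = x
    · exact .inr hkx
    refine .inl ?_
    have hadj : DAdjacent G₁ k x := by
      by_contra hn
      exact hG₂.asymm hyx ((h.imm k x y hkx hn).1 ⟨hky, hxy⟩).2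
    refine hadj.resolve_right fun hxk => ?_
    have hxk₂ := agree hky hxk
    have hky₂ : G₂.Adj k y := ((h.adj k y).1 (.inl hky)).resolve_right fun hyk =>
      hxmax k ⟨hky, hyk⟩ (.single hxk)
    exact hG₂ x (((Relation.TransGen.single hxk₂).tail hky₂).tail hyx)
  · rintro (hkx | rfl)
    · have hky : k ≠ y := by
        rintro rfl
        exact hG₁.asymm hxy hkx
      have hadj : DAdjacent G₁ k y := by
        by_contra hn
        exact hG₁.asymm hxy ((h.imm k y x hky hn).2 ⟨agree hxy hkx, hyx⟩).2
      exact hadj.resolve_right fun hyk =>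
        hG₁ k (((Relation.TransGen.single hkx).tail hxy).tail hyk)
    · exact hxy

/-- Chickering's theorem, as an induction principle: a property that passes from a DAG to its
reversals of covered edges passes from a DAG to every DAG with the same adjacencies and
immoralities. -/
theorem SameImmoralities.induction_isCovered [Finite V] {P : Digraph V → Prop}
    (hP : ∀ G x y, IsDAG G → IsCovered G x y → P G → P (reverseEdge G x y))
    (hG₂ : IsDAG G₂) (hG₁ : IsDAG G₁) (h : SameImmoralities G₁ G₂) (h₁ : P G₁) : P G₂ := by
  -- Induction on the number of edges on which the two graphs disagree.
  induction hm : {e : V × V | G₁.Adj e.1 e.2 ∧ G₂.Adj e.2 e.1}.ncard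
    using Nat.strong_induction_on generalizing G₁ with
  | _ m ih =>
    by_cases hex : ∃ x y, G₁.Adj x y ∧ G₂.Adj y x
    · obtain ⟨x, y, hc, hyx⟩ := h.exists_isCovered hG₁ hG₂ hex
      refine ih _ ?_ (hc.isDAG_reverseEdge hG₁) ((hc.sameImmoralities_reverseEdge hG₁).trans h)
        (hP _ _ _ hG₁ hc h₁) rfl
      rw [← hm]
      refine Set.ncard_lt_ncard ⟨?_, fun hsub => ?_⟩ (Set.toFinite _)
      · rintro ⟨a, b⟩ ⟨hab | ⟨ha, hb⟩, hba⟩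
        · exact ⟨hab.1, hba⟩
        · dsimp only at ha hb hba
          subst ha hb
          exact absurd hba (hG₂.asymm hyx)
      · have hmem := (@hsub (x, y) ⟨hc.adj, hyx⟩).1
        rcases hmem with hmem | hmem
        · exact hmem.2 ⟨rfl, rfl⟩
        · exact hc.ne hG₁ hmem.2.symm
    · push Not at hex
      have heq : G₁ = G₂ := by
        ext a b
        exact ⟨fun hab => ((h.adj a b).1 (.inl hab)).resolve_right (hex a b hab),
          fun hab => ((h.adj a b).2 (.inl hab)).resolve_right fun hba => hex b a hba hab⟩
      exact heq ▸ h₁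

end CoveredEdges

/-! ### The likelihood under reversal of a covered edge -/

/-- Two families that agree away from two indices, and whose products over these two indices agree,
have the same product. -/
@[to_additive /-- Two families that agree away from two indices, and whose sums over these two
indices agree, have the same sum. -/]
theorem Fintype.prod_eq_prod_of_pair {ι M : Type*} [Fintype ι] [DecidableEq ι] [CommMonoid M]
    {f g : ι → M} {x y : ι} (hxy : x ≠ y) (hpair : f x * f y = g x * g y)
    (hrest : ∀ j, j ≠ x → j ≠ y → f j = g j) : ∏ j, f j = ∏ j, g j := by
  have hy : y ∈ Finset.univ.erase x := by simp [hxy.symm]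
  rw [← Finset.mul_prod_erase _ f (Finset.mem_univ x), ← Finset.mul_prod_erase _ g
    (Finset.mem_univ x), ← Finset.mul_prod_erase _ f hy, ← Finset.mul_prod_erase _ g hy,
    ← mul_assoc, ← mul_assoc, hpair]
  congr 1
  refine Finset.prod_congr rfl fun j hj => hrest j ?_ ?_
  · exact Finset.ne_of_mem_erase (Finset.mem_of_mem_erase hj)
  · exact Finset.ne_of_mem_erase hj

theorem Matrix.IsDiag.det_inv {ι : Type*} [Fintype ι] [DecidableEq ι] {D : Matrix ι ι ℝ}
    (hD : D.IsDiag) : (D⁻¹).det = ∏ j, (D j j)⁻¹ := by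
  rw [Matrix.det_nonsing_inv, ← hD.diagonal_diag, Matrix.det_diagonal, Ring.inverse_eq_inv',
    ← Finset.prod_inv_distrib]
  simp

/-- Reversing a covered edge of a DAG does not lose any value of the negative log-likelihood. -/
theorem IsCovered.exists_negLogLik_eq {n p : ℕ} {G : Digraph (Fin p)} {x y : Fin p}
    (h : IsCovered G x y) (hG : IsDAG G) (A : SimpleGraph (Fin n))
    (X : Matrix (Fin n) (Fin p) ℝ) {θ : ModelParams n p} (hθ : θ ∈ parameterSet G A) :
    ∃ θ' ∈ parameterSet (reverseEdge G x y) A, negLogLik X θ' = negLogLik X θ := by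
  obtain ⟨hB, ⟨hdiag, hpos⟩, hΘ⟩ := hθ
  have hne := h.ne hG
  obtain ⟨B, Ω, Θ⟩ := θ
  dsimp only at hB hdiag hpos hΘ
  -- With `a = 1 / ω_x²`, `c = 1 / ω_y²`, `b = β_xy` and `s = a + c b²`, the residuals satisfy
  -- `a r_x² + c r_y² = s ((a r_x - c b r_y) / s)² + (a c / s) (r_y + b r_x)²`,
  -- and `r_y + b r_x` no longer involves the `x`-th column.
  set b := B x y with hb
  set a := (Ω x x)⁻¹ with ha
  set c := (Ω y y)⁻¹ with hc
  have ha0 : 0 < a := inv_pos.2 (hpos x)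
  have hc0 : 0 < c := inv_pos.2 (hpos y)
  set s := a + c * b ^ 2 with hs
  have hs0 : 0 < s := by positivity
  let ω : Fin p → ℝ := fun j => if j = x then s⁻¹ else if j = y then s / (a * c) else Ω j j
  let B' : Matrix (Fin p) (Fin p) ℝ := Matrix.of fun k j =>
    if j = x then (Pi.single x 1 - s⁻¹ • (a • (Pi.single x 1 - B.col x)
      - (c * b) • (Pi.single y 1 - B.col y)) : Fin p → ℝ) k
    else if j = y then (B.col y - b • (Pi.single x 1 - B.col x) : Fin p → ℝ) k
    else B k j
  have hωx : ω x = s⁻¹ := by simp [ω]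
  have hωy : ω y = s / (a * c) := by simp [ω, hne.symm]
  have hω : ∀ j, j ≠ x → j ≠ y → ω j = Ω j j := fun j hx hy => by simp [ω, hx, hy]
  have hBx : B'.col x = Pi.single x 1 - s⁻¹ • (a • (Pi.single x 1 - B.col x)
      - (c * b) • (Pi.single y 1 - B.col y)) := by
    ext k; simp [B', Matrix.col]
  have hBy : B'.col y = B.col y - b • (Pi.single x 1 - B.col x) := by
    ext k; simp [B', Matrix.col, hne.symm]
  have hBj : ∀ j, j ≠ x → j ≠ y → B'.col j = B.col j := fun j hx hy => by
    ext k; simp [B', Matrix.col, hx, hy]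
  refine ⟨⟨B', Matrix.diagonal ω, Θ⟩, ⟨?_, ⟨Matrix.isDiag_diagonal ω, ?_⟩, hΘ⟩, ?_⟩
  · intro k j hkj
    rw [reverseEdge_adj] at hkj
    have hk := h k
    have hxx := hB x x (hG.irrefl x)
    by_cases hjx : j = x
    · subst hjx
      have hky : k ≠ y := fun hky => hkj (.inr ⟨hky, rfl⟩)
      have hkj' : ¬ G.Adj k j := fun h' => hkj (.inl ⟨h', fun h'' => hne h''.2⟩)
      change B'.col j k = 0
      rw [hBx]
      by_cases hkx : k = j
      · subst hkx
        simp [hxx, hne, ← hb]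
        field_simp
        rw [hs]; ring
      · have hky' : ¬ G.Adj k y := fun h' => (hk.1 h').elim hkj' hkx
        simp [hkx, hky, hB k j hkj', hB k y hky']
    · by_cases hjy : j = y
      · subst hjy
        change B'.col j k = 0
        rw [hBy]
        by_cases hkx : k = x
        · subst hkx
          simp [hxx, ← hb]
        · have hkj' : ¬ G.Adj k j := fun h' => hkj (.inl ⟨h', fun h'' => hkx h''.1⟩)
          have hkx' : ¬ G.Adj k x := fun h' => hkj' (hk.2 (.inl h'))
          simp [hkx, hB k j hkj', hB k x hkx']
      · change B'.col j k = 0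
        rw [hBj j hjx hjy]
        exact hB k j fun h' => hkj (.inl ⟨h', fun h'' => hjy h''.2⟩)
  · intro j
    simp only [Matrix.diagonal_apply_eq, ω]
    split_ifs
    · positivity
    · positivity
    · exact hpos j
  · have hdet : ((Matrix.diagonal ω)⁻¹).det = (Ω⁻¹).det := by
      rw [(Matrix.isDiag_diagonal ω).det_inv, hdiag.det_inv]
      refine Fintype.prod_eq_prod_of_pair hne ?_ fun j hx hy => ?_
      · simp only [Matrix.diagonal_apply_eq, hωx, hωy, ← ha, ← hc]
        field_simp
      · rw [Matrix.diagonal_apply_eq, hω j hx hy]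
    have hscatter : rowScatter X B' (Matrix.diagonal ω) = rowScatter X B Ω := by
      unfold rowScatter
      congr 1
      refine Fintype.sum_eq_sum_of_pair hne ?_ fun j hx hy => ?_
      · set rx := X.col x - X.mulVec (B.col x) with hrx
        set ry := X.col y - X.mulVec (B.col y) with hry
        have hx' : X.col x - X.mulVec (B'.col x) = s⁻¹ • (a • rx - (c * b) • ry) := by
          rw [hBx, hrx, hry]
          simp [Matrix.mulVec_sub, Matrix.mulVec_smul]
        have hy' : X.col y - X.mulVec (B'.col y) = ry + b • rx := by
          rw [hBy, hrx, hry]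
          simp only [Matrix.mulVec_sub, Matrix.mulVec_smul, Matrix.mulVec_single_one]
          abel
        rw [hx', hy']
        ext i k
        simp only [Matrix.add_apply, Matrix.smul_apply, Matrix.vecMulVec_apply, Pi.add_apply,
          Pi.sub_apply, Pi.smul_apply, smul_eq_mul, Matrix.diagonal_apply_eq, hωx, hωy,
          one_div, ← ha, ← hc]
        field_simp
        rw [hs]
        ring
      · rw [hBj j hx hy, Matrix.diagonal_apply_eq, hω j hx hy]
    simp only [negLogLik, hdet, hscatter]

theorem MarkovEquivalent.exists_negLogLik_eq {n p : ℕ} {G₁ G₂ : Digraph (Fin p)}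
    (h : MarkovEquivalent G₁ G₂) (hG₁ : IsDAG G₁) (hG₂ : IsDAG G₂) (A : SimpleGraph (Fin n))
    (X : Matrix (Fin n) (Fin p) ℝ) {θ : ModelParams n p} (hθ : θ ∈ parameterSet G₁ A) :
    ∃ θ' ∈ parameterSet G₂ A, negLogLik X θ' = negLogLik X θ := by
  refine (h.sameImmoralities hG₁ hG₂).induction_isCovered
    (P := fun G => ∃ θ' ∈ parameterSet G A, negLogLik X θ' = negLogLik X θ)
    ?_ hG₂ hG₁ ⟨θ, hθ, rfl⟩
  rintro G x y hG hc ⟨θ', hθ', heq⟩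
  obtain ⟨θ'', hθ'', heq'⟩ := hc.exists_negLogLik_eq hG A X hθ'
  exact ⟨θ'', hθ'', heq'.trans heq⟩

theorem theorem1 (n p : ℕ) (A : SimpleGraph (Fin n)) (X : Matrix (Fin n) (Fin p) ℝ)
    (G₁ G₂ : Digraph (Fin p)) (hG₁ : IsDAG G₁) (hG₂ : IsDAG G₂)
    (hG : MarkovEquivalent G₁ G₂)
    (θ₁ θ₂ : ModelParams n p) (hθ₁ : IsMLE G₁ A X θ₁) (hθ₂ : IsMLE G₂ A X θ₂) :
    negLogLik X θ₁ = negLogLik X θ₂ := by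
  obtain ⟨η₂, hη₂, h₂⟩ := hG.exists_negLogLik_eq hG₁ hG₂ A X hθ₁.1
  obtain ⟨η₁, hη₁, h₁⟩ := hG.symm.exists_negLogLik_eq hG₂ hG₁ A X hθ₂.1
  exact le_antisymm (h₁ ▸ hθ₁.2 hη₁) (h₂ ▸ hθ₂.2 hη₂)
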